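/- Let $q=2^r$ with $r\ge 1$, let $\mathbb{F}_q$ be the field with $q$ elements, let $\mathrm{tr}(x)=x+x^2+\cdots+x^{2^{r-1}}$ be the trace $\mathbb{F}_q\to\mathbb{F}_2$, let $\lambda(x)=(-1)^{\mathrm{tr}(x)}$ be the canonical additive character of $\mathbb{F}_q$, and for $a\in\mathbb{F}_q^*$ let $$K(\lambda;a)=\sum_{\alpha\in\mathbb{F}_q^*}\lambda(\alpha+a\alpha^{-1})$$ be the Kloosterman sum. For an integer $n\ge 1$ let $O(2n+1,q)$ be the group of isometries of the quadratic form $\theta(x)=\sum_{i=1}^n x_ix_{n+i}+x_{2n+1}^2$ on $\mathbb{F}_q^{2n+1}$, and let $P=P(2n+1,q)$ be its maximal parabolic subgroup consisting of the matrices $$\begin{bmatrix}A&0&0\\0&{}^tA^{-1}&0\\0&0&1\end{bmatrix}\begin{bmatrix}1_n&B&0\\0&1_n&0\\0&h&1\end{bmatrix},$$ where $A\in GL(n,q)$, $B$ is an $n\times n$ matrix and $h$ a $1\times n$ row over $\mathbb{F}_q$ such that $B+{}^th\,h$ is alternating (that is, it has zero diagonal and is skew-symmetric). For $0\le s\le n$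 let $\sigma_s\in O(2n+1,q)$ be the permutation matrix that exchanges the coordinates $i$ and $n+i$ for $1\le i\le s$ and fixes all other coordinates, and let $DC(n,q)=P\sigma_{n-1}P$. For odd $n$ put $$A(n,q)=q^{\frac14(5n^2-1)}\begin{bmatrix}n\\1\end{bmatrix}_q\prod_{j=1}^{(n-1)/2}(q^{2j-1}-1),\qquad \begin{bmatrix}n\\s\end{bmatrix}_q=\prod_{j=0}^{s-1}\frac{q^{n-j}-1}{q^{s-j}-1}.$$ Then for every $a\in\mathbb{F}_q^*$ and every odd integer $n\ge 1$, $$\sum_{w\in DC(n,q)}\lambda(a\,\mathrm{Tr}\,w)=\lambda(a)\,A(n,q)\,K(\lambda;a),$$ where $\mathrm{Tr}\,w$ denotes the trace of the matrix $w$. -/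

import Mathlib

open scoped Matrix

namespace OrthKloosterman

/-- The trace function `x ↦ x + x ^ 2 + ⋯ + x ^ (2 ^ (r - 1))` of the field with `2 ^ r` elements.
Its values lie in the prime field `{0, 1}`. -/
def tr {F : Type*} [Field F] (r : ℕ) (x : F) : F :=
  ∑ i ∈ Finset.range r, x ^ (2 ^ i)

/-- The canonical additive character `x ↦ (-1) ^ tr x` of the field with `2 ^ r` elements. -/
noncomputable def lam {F : Type*} [Field F] [DecidableEq F] (r : ℕ) (x : F) : ℂ :=
  if tr r x = 0 then 1 else -1

/-- The Kloosterman sum `K(ψ; a)`, the sum of `ψ (α + a * α⁻¹)` over all nonzero `α`. -/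
noncomputable def kloosterman {F : Type*} [Field F] [Fintype F] [DecidableEq F]
    (ψ : F → ℂ) (a : F) : ℂ :=
  ∑ α : Fˣ, ψ ((α : F) + a * (α : F)⁻¹)

/-- The `q`-binomial coefficient, the product over `0 ≤ j < r` of
`(q ^ (n - j) - 1) / (q ^ (r - j) - 1)`, used for `r ≤ n` and `q ≥ 2`. -/
noncomputable def qBinom (q n r : ℕ) : ℂ :=
  ∏ j ∈ Finset.range r, ((q : ℂ) ^ (n - j) - 1) / ((q : ℂ) ^ (r - j) - 1)

/-- The constant `A(n, q)`, used for odd `n`; then `4 ∣ 5 * n ^ 2 - 1` and `2 ∣ n - 1`,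
so that the divisions are exact. -/
noncomputable def A (n q : ℕ) : ℂ :=
  (q : ℂ) ^ ((5 * n ^ 2 - 1) / 4) * qBinom q n 1 *
    ∏ j ∈ Finset.Icc 1 ((n - 1) / 2), ((q : ℂ) ^ (2 * j - 1) - 1)

/-- The `2 * n + 1` coordinates, in the order `1, …, n`, then `n + 1, …, 2 * n`, then `2 * n + 1`. -/
abbrev Idx (n : ℕ) : Type := (Fin n ⊕ Fin n) ⊕ Unit

/-- An alternating square matrix. -/
def IsAlternating {F : Type*} [Field F] {n : ℕ} (M : Matrix (Fin n) (Fin n) F) : Prop :=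
  (∀ i, M i i = 0) ∧ ∀ i j, M i j = -M j i

/-- The quadratic form `θ`, the sum of the `x i * x (n + i)` plus the square of the last
coordinate. -/
def theta {F : Type*} [Field F] {n : ℕ} (x : Idx n → F) : F :=
  ∑ i, x (Sum.inl (Sum.inl i)) * x (Sum.inl (Sum.inr i)) + x (Sum.inr ()) ^ 2

/-- The orthogonal group `O(2n+1, q)` of all isometries of `θ`. -/
def O (F : Type*) [Field F] (n : ℕ) : Set (Matrix (Idx n) (Idx n) F) :=
  {w | IsUnit w ∧ ∀ x, theta (w *ᵥ x) = theta x}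

/-- The Levi factor `diag(A, ᵗA⁻¹, 1)`. -/
def levi {F : Type*} [Field F] {n : ℕ} (A : GL (Fin n) F) : Matrix (Idx n) (Idx n) F :=
  Matrix.fromBlocks
    (Matrix.fromBlocks (A : Matrix (Fin n) (Fin n) F) 0
      0 ((A⁻¹ : GL (Fin n) F) : Matrix (Fin n) (Fin n) F)ᵀ) 0
    0 1

/-- The matrix with block rows `(1, B, 0)`, `(0, 1, 0)` and `(0, h, 1)`. -/
def unip {F : Type*} [Field F] {n : ℕ} (B : Matrix (Fin n) (Fin n) F)
    (h : Matrix Unit (Fin n) F) : Matrix (Idx n) (Idx n) F :=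
  Matrix.fromBlocks (Matrix.fromBlocks 1 B 0 1) 0 (Matrix.fromCols 0 h) 1

/-- The maximal parabolic subgroup `P(2n+1, q)` of `O(2n+1, q)`. -/
def P (F : Type*) [Field F] (n : ℕ) : Set (Matrix (Idx n) (Idx n) F) :=
  {w | ∃ (A : GL (Fin n) F) (B : Matrix (Fin n) (Fin n) F) (h : Matrix Unit (Fin n) F),
    IsAlternating (B + hᵀ * h) ∧ w = levi A * unip B h}

/-- The Weyl element `σ_r`: it exchanges the coordinates `i` and `n + i` for the first `r` values
of `i` and fixes the others. -/
def sigma (F : Type*) [Field F] (n r : ℕ) : Matrix (Idx n) (Idx n) F :=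
  Matrix.fromBlocks
    (Matrix.fromBlocks
      (Matrix.diagonal fun i : Fin n => if (i : ℕ) < r then 0 else 1)
      (Matrix.diagonal fun i : Fin n => if (i : ℕ) < r then 1 else 0)
      (Matrix.diagonal fun i : Fin n => if (i : ℕ) < r then 1 else 0)
      (Matrix.diagonal fun i : Fin n => if (i : ℕ) < r then 0 else 1)) 0
    0 1

/-- The double coset `DC(n, q) = P σ_{n-1} P`, used for `n ≥ 1`. -/
def DC (F : Type*) [Field F] (n : ℕ) : Set (Matrix (Idx n) (Idx n) F) :=
  DoubleCoset.doubleCoset (sigma F n (n - 1)) (P F n) (P F n)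

section Membership

open Matrix

theorem IsAlternating.dotProduct_mulVec_self {F : Type*} [Field F] {n : ℕ}
    {M : Matrix (Fin n) (Fin n) F} (hM : IsAlternating M) (v : Fin n → F) :
    v ⬝ᵥ (M *ᵥ v) = 0 := by
  simp only [dotProduct, mulVec, Finset.mul_sum, ← Finset.sum_product']
  refine Finset.sum_involution (fun p _ => (p.2, p.1)) ?_ ?_ ?_ ?_
  · rintro ⟨i, j⟩ _
    rw [hM.2 i j]
    ring
  · rintro ⟨i, j⟩ _ hne h
    obtain rfl : j = i := congrArg Prod.fst h
    exact hne (by simp [hM.1])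
  · simp
  · simp

theorem exists_elim {F : Type*} {n : ℕ} (x : Idx n → F) :
    ∃ u v z, x = Sum.elim (Sum.elim u v) z :=
  ⟨fun i => x (.inl (.inl i)), fun i => x (.inl (.inr i)), fun i => x (.inr i), by
      ext i; rcases i with (i | i) | i <;> rfl⟩

theorem theta_elim {F : Type*} [Field F] {n : ℕ} (u v : Fin n → F) (z : Unit → F) :
    theta (Sum.elim (Sum.elim u v) z) = u ⬝ᵥ v + z () ^ 2 := rfl

theorem theta_unip {F : Type*} [Field F] [CharP F 2] {n : ℕ} (B : Matrix (Fin n) (Fin n) F)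
    (h : Matrix Unit (Fin n) F) (hB : IsAlternating (B + hᵀ * h)) (x : Idx n → F) :
    theta (unip B h *ᵥ x) = theta x := by
  obtain ⟨u, v, z, rfl⟩ := exists_elim x
  have key := hB.dotProduct_mulVec_self v
  have h1 : v ⬝ᵥ ((hᵀ * h) *ᵥ v) = (h *ᵥ v) () ^ 2 := by
    rw [← mulVec_mulVec, dotProduct_mulVec, vecMul_transpose]
    simp [dotProduct, sq]
  rw [add_mulVec, dotProduct_add, h1] at key
  have h2 : unip B h *ᵥ Sum.elim (Sum.elim u v) z =
      Sum.elim (Sum.elim (u + B *ᵥ v) v) (h *ᵥ v + z) := by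
    simp [unip, fromBlocks_mulVec, fromCols_mulVec, Function.comp_def]
  rw [h2, theta_elim, theta_elim, add_dotProduct, dotProduct_comm (B *ᵥ v) v, Pi.add_apply, CharTwo.add_sq]
  linear_combination key

theorem sigma_mulVec {F : Type*} [Field F] {n r : ℕ} (u v : Fin n → F) (z : Unit → F) :
    sigma F n r *ᵥ Sum.elim (Sum.elim u v) z =
      Sum.elim (Sum.elim (fun i : Fin n => if (i : ℕ) < r then v i else u i)
        (fun i : Fin n => if (i : ℕ) < r then u i else v i)) z := by
  ext i
  rcases i with (i | i) | i <;> simp [sigma, fromBlocks_mulVec, Function.comp_def, mulVec_diagonal] <;> split_ifs <;> simp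

/-- `σ_r` is an isometry of `θ`. -/
theorem sigma_mem_O (F : Type*) [Field F] (n r : ℕ) : sigma F n r ∈ O F n := by
  refine ⟨?_, fun x => ?_⟩
  · refine IsUnit.of_mul_eq_one (sigma F n r) ?_
    refine ext_of_mulVec_single (M := sigma F n r * sigma F n r) (N := 1) fun i => ?_
    obtain ⟨u, v, z, h⟩ := exists_elim (Pi.single i (1 : F) : Idx n → F)
    rw [h, ← mulVec_mulVec, sigma_mulVec, sigma_mulVec, one_mulVec]
    congr 2 <;> ext i <;> split_ifs <;> rfl
  · obtain ⟨u, v, z, rfl⟩ := exists_elim x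
    rw [sigma_mulVec, theta_elim, theta_elim]
    congr 1
    refine Finset.sum_congr rfl fun i _ => ?_
    by_cases hi : (i : ℕ) < r <;> simp [hi, mul_comm]

theorem theta_levi {F : Type*} [Field F] {n : ℕ} (A : GL (Fin n) F) (x : Idx n → F) :
    theta (levi A *ᵥ x) = theta x := by
  obtain ⟨u, v, z, rfl⟩ := exists_elim x
  have key : ((A : Matrix (Fin n) (Fin n) F) *ᵥ u) ⬝ᵥ (((A⁻¹ : GL (Fin n) F) : Matrix (Fin n) (Fin n) F)ᵀ *ᵥ v) = u ⬝ᵥ v := by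
    rw [Matrix.mulVec_transpose, dotProduct_comm, ← Matrix.dotProduct_mulVec, Matrix.mulVec_mulVec, ← Units.val_mul]
    simp [dotProduct_comm]
  simp only [levi, Matrix.fromBlocks_mulVec, theta]
  simpa [dotProduct, Function.comp_def] using key

/-- In characteristic two every element of `P(2n+1, q)` is an isometry of `θ`. -/
theorem P_subset_O (F : Type*) [Field F] [CharP F 2] (n : ℕ) : P F n ⊆ O F n := by
  rintro w ⟨A, B, h, hB, rfl⟩
  refine ⟨?_, fun x => ?_⟩
  · rw [isUnit_iff_isUnit_det]
    have hA := A⁻¹.isUnit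
    have hA' := A.isUnit
    rw [isUnit_iff_isUnit_det] at hA hA'
    simp only [levi, unip, det_mul, det_fromBlocks_zero₁₂, det_fromBlocks_zero₂₁, det_one, mul_one, det_transpose]
    exact hA'.mul hA
  · rw [← mulVec_mulVec, theta_levi, theta_unip B h hB]
end Membership

end OrthKloosterman

open scoped Matrix

namespace OrthKloosterman

/-! ### Trace and canonical additive character in characteristic 2. -/

section Character

variable {F : Type*} [Field F]

/-! Write n = k + 1 and σ = σ_k. Since w ↦ λ(a Tr w) takes equal values at xy and yx, averaging over
P × P gives |P ∩ σPσ| · Σ_{DC} = |P| · Σ_{x ∈ P} λ(a Tr(xσ)) (`card_mul_sum_doubleCoset`).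

Parametrize x by A, B, h. In characteristic 2 the pairs (B, h) form an additive group: B is
symmetric with diagonal entries h_i². Then Tr(xσ) = Tr(A'B) + A_nn + (A⁻¹)_nn + 1, where A' is A
with its last row erased. By orthogonality the sum over (B, h) vanishes unless A' is alternating
(`sum_lam_trace_unipParam`). In that case A is block lower triangular, with a nonsingular
alternating k × k block, a free row w and a corner d; the summand depends only on d. The sum over d
of λ(a(d + d⁻¹)) is K(λ; a²) = K(λ; a), by Frobenius invariance of λ (`sum_lam_unit_add_inv`).

It remains to count nonsingular alternating matrices by recursion on the size
(`numNonsingAlt_add_two`), and P ∩ σPσ by viewing P as the stabilizer of a subspace (`mem_P_iff`,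
`sigma_conj_mem_P_iff`). For n = 2m + 1 the powers of q then combine into A(n, q). -/

theorem tr_add [CharP F 2] (r : ℕ) (x y : F) : tr r (x + y) = tr r x + tr r y := by
  simp only [tr, ← Finset.sum_add_distrib]
  exact Finset.sum_congr rfl fun i _ => add_pow_char_pow (p := 2) x y i

theorem tr_sq_eq_sum (r : ℕ) (x : F) : tr r (x ^ 2) = ∑ i ∈ Finset.range r, x ^ 2 ^ (i + 1) :=
  Finset.sum_congr rfl fun i _ => by rw [← pow_mul, pow_succ' 2 i]

theorem sq_tr [CharP F 2] (r : ℕ) (x : F) : tr r x ^ 2 = tr r (x ^ 2) := by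
  rw [tr_sq_eq_sum, tr, sum_pow_char 2]
  exact Finset.sum_congr rfl fun i _ => by rw [← pow_mul, pow_succ 2 i]

variable [Fintype F]

/-- Squaring permutes the terms of the trace cyclically, because x ^ 2 ^ r = x. -/
theorem tr_sq [CharP F 2] {r : ℕ} (hF : Fintype.card F = 2 ^ r) (x : F) : tr r (x ^ 2) = tr r x := by
  have h1 := Finset.sum_range_succ (fun i => x ^ 2 ^ i) r
  rw [Finset.sum_range_succ', ← tr_sq_eq_sum, ← hF, FiniteField.pow_card] at h1
  simpa [tr] using h1

theorem tr_eq_zero_or_one [CharP F 2] {r : ℕ} (hF : Fintype.card F = 2 ^ r) (x : F) :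
    tr r x = 0 ∨ tr r x = 1 := by
  have h : tr r x * (tr r x - 1) = 0 := by
    linear_combination sq_tr r x + tr_sq hF x
  rcases mul_eq_zero.1 h with h | h
  · exact .inl h
  · exact .inr (sub_eq_zero.1 h)

/-- The trace is a polynomial of degree at most 2 ^ (r - 1), nonzero because its linear coefficient
is 1, so it cannot vanish at all 2 ^ r points. -/
theorem exists_tr_ne_zero {r : ℕ} (hF : Fintype.card F = 2 ^ r) : ∃ x : F, tr r x ≠ 0 := by
  by_contra! h
  obtain ⟨m, rfl⟩ : ∃ m, r = m + 1 := by
    refine Nat.exists_eq_succ_of_ne_zero ?_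
    rintro rfl
    have := Fintype.one_lt_card (α := F)
    omega
  let p : Polynomial F := ∑ i ∈ Finset.range (m + 1), Polynomial.X ^ (2 ^ i)
  have hp : p.coeff 1 = 1 := by
    simp only [p, Polynomial.finsetSum_coeff, Polynomial.coeff_X_pow]
    rw [Finset.sum_eq_single 0] <;> simp
    intro b _ hb hb'
    exact hb ((Nat.pow_eq_one.1 hb'.symm).resolve_left (by norm_num))
  have hp0 : p ≠ 0 := fun h0 => by simp [h0] at hp
  have hdeg : p.natDegree ≤ 2 ^ m := by
    refine Polynomial.natDegree_sum_le_of_forall_le _ _ fun i hi => ?_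
    rw [Polynomial.natDegree_X_pow]
    exact Nat.pow_le_pow_right (by norm_num) (Nat.lt_succ_iff.1 (Finset.mem_range.1 hi))
  have hcard : Fintype.card F ≤ p.natDegree := by
    rw [← Finset.card_univ]
    refine Polynomial.card_le_degree_of_subset_roots fun x _ => ?_
    rw [Polynomial.mem_roots hp0, Polynomial.IsRoot.def]
    simpa [p, Polynomial.eval_finsetSum, tr] using h x
  have : 0 < 2 ^ m := by positivity
  rw [hF, pow_succ] at hcard
  omega

variable [DecidableEq F]

/-- The canonical additive character as an `AddChar`. -/
noncomputable def lamChar [CharP F 2] {r : ℕ} (hF : Fintype.card F = 2 ^ r) : AddChar F ℂ where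
  toFun := lam r
  map_zero_eq_one' := by simp [lam, tr]
  map_add_eq_mul' x y := by
    simp only [lam, tr_add]
    rcases tr_eq_zero_or_one hF x with hx | hx <;> rcases tr_eq_zero_or_one hF y with hy | hy <;>
      simp [hx, hy, CharTwo.add_self_eq_zero]

theorem lam_sq [CharP F 2] {r : ℕ} (hF : Fintype.card F = 2 ^ r) (x : F) : lam r (x ^ 2) = lam r x := by
  rw [lam, lam, tr_sq hF]

theorem eq_zero_of_forall_lam {r : ℕ} (hF : Fintype.card F = 2 ^ r) {b : F}
    (h : ∀ c : F, lam r (c * b) = 1) : b = 0 := by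
  by_contra hb
  obtain ⟨x, hx⟩ := exists_tr_ne_zero hF
  have := h (x * b⁻¹)
  rw [inv_mul_cancel_right₀ hb, lam, if_neg hx] at this
  norm_num at this

/-- Both sides equal K(λ; a²): put α = ad for the left, and α = d² together with λ(x²) = λ(x) for
the right. -/
theorem sum_lam_unit_add_inv [CharP F 2] {r : ℕ} (hF : Fintype.card F = 2 ^ r) {a : F} (ha : a ≠ 0) :
    ∑ d : Fˣ, lam r (a * ((d : F) + (d : F)⁻¹)) = kloosterman (lam r) a := by
  have h1 : kloosterman (lam r) (a ^ 2) = ∑ d : Fˣ, lam r (a * ((d : F) + (d : F)⁻¹)) := by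
    refine (Fintype.sum_equiv (Equiv.mulLeft (Units.mk0 a ha)) _ _ fun d => ?_).symm
    have := d.ne_zero
    congr 1
    simp
    field_simp
  rw [← h1]
  have hbij : Function.Bijective fun d : Fˣ => d ^ 2 := by
    refine Finite.injective_iff_bijective.1 fun x y hxy => Units.ext ?_
    have : (x : F) ^ 2 = (y : F) ^ 2 := by simpa using congrArg Units.val hxy
    exact frobenius_inj F 2 this
  refine (Fintype.sum_bijective _ hbij _ _ fun d => ?_).symm
  rw [← lam_sq hF, CharTwo.add_sq, mul_pow, Units.val_pow_eq_pow_val, inv_pow]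

end Character

/-! ### Counting nonsingular alternating matrices. -/

section AlternatingCount

open Matrix

variable {F : Type*} [Field F]

theorem IsAlternating.congruence {k : ℕ} {M : Matrix (Fin k) (Fin k) F} (hM : IsAlternating M)
    (g : Matrix (Fin k) (Fin k) F) : IsAlternating (gᵀ * M * g) := by
  have hT : Mᵀ = -M := by
    ext i j
    exact hM.2 j i
  refine ⟨fun i => ?_, fun i j => ?_⟩
  · have := hM.dotProduct_mulVec_self (fun j => g j i)
    rw [← this, Matrix.mul_assoc, Matrix.mul_apply]
    rfl
  · have : (gᵀ * M * g)ᵀ = -(gᵀ * M * g) := by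
      simp [Matrix.transpose_mul, hT, Matrix.mul_assoc]
    exact congrFun (congrFun this j) i

/-- The alternating matrix with first row `(0, v)` and lower right block `M`. -/
def altCons {k : ℕ} (v : Fin k → F) (M : Matrix (Fin k) (Fin k) F) :
    Matrix (Fin (k + 1)) (Fin (k + 1)) F :=
  of (Fin.cons (Fin.cons 0 v) fun i => Fin.cons (-v i) (M i))

section Entries

variable {k : ℕ} (v : Fin k → F) (M : Matrix (Fin k) (Fin k) F)

@[simp] theorem altCons_zero_zero : altCons v M 0 0 = 0 := rfl

@[simp] theorem altCons_zero_succ (j : Fin k) : altCons v M 0 j.succ = v j := rfl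

@[simp] theorem altCons_succ_zero (i : Fin k) : altCons v M i.succ 0 = -v i := rfl

@[simp] theorem altCons_succ_succ (i j : Fin k) : altCons v M i.succ j.succ = M i j := rfl

theorem isAlternating_altCons_iff : IsAlternating (altCons v M) ↔ IsAlternating M := by
  simp [IsAlternating, Fin.forall_fin_succ]

end Entries

/-- Alternating matrices of size `k + 1` are given by a first row and an alternating block. -/
def altConsEquiv (F : Type*) [Field F] (k : ℕ) :
    (Fin k → F) × {M : Matrix (Fin k) (Fin k) F // IsAlternating M} ≃
      {M : Matrix (Fin (k + 1)) (Fin (k + 1)) F // IsAlternating M} where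
  toFun p := ⟨altCons p.1 p.2, (isAlternating_altCons_iff _ _).2 p.2.2⟩
  invFun M := (fun j => M.1 0 j.succ, ⟨M.1.submatrix Fin.succ Fin.succ,
    fun i => M.2.1 i.succ, fun i j => M.2.2 i.succ j.succ⟩)
  left_inv _ := rfl
  right_inv M := by
    refine Subtype.ext (Matrix.ext fun i j => ?_)
    induction i using Fin.cases with
    | zero =>
      induction j using Fin.cases with
      | zero => exact (M.2.1 0).symm
      | succ j => rfl
    | succ i =>
      induction j using Fin.cases with
      | zero => exact (M.2.2 i.succ 0).symm
      | succ j => rfl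

theorem card_alternating (F : Type*) [Field F] [Fintype F] (k : ℕ) :
    Nat.card {M : Matrix (Fin k) (Fin k) F // IsAlternating M} =
      Fintype.card F ^ (k * (k - 1) / 2) := by
  rw [← Nat.choose_two_right]
  induction k with
  | zero =>
    have : Unique {M : Matrix (Fin 0) (Fin 0) F // IsAlternating M} :=
      { default := ⟨0, fun i => i.elim0, fun i => i.elim0⟩
        uniq := fun M => Subtype.ext (Subsingleton.elim _ _) }
    simp
  | succ k ih =>
    rw [← Nat.card_congr (altConsEquiv F k), Nat.card_prod, ih, Nat.choose_succ_succ' k 1, pow_add]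
    simp

/-- The number of nonsingular alternating matrices of size `k`. -/
noncomputable def numNonsingAlt (F : Type*) [Field F] (k : ℕ) : ℕ :=
  Nat.card {M : Matrix (Fin k) (Fin k) F // IsAlternating M ∧ IsUnit M.det}

theorem exists_det_ne_zero_row_zero {k : ℕ} {v : Fin (k + 1) → F} (hv : v ≠ 0) :
    ∃ g : Matrix (Fin (k + 1)) (Fin (k + 1)) F, IsUnit g.det ∧ g 0 = v := by
  obtain ⟨i, hi⟩ := Function.ne_iff.1 hv
  -- Put v in row i of the identity, where v i ≠ 0, and swap that row to the top: the determinant is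
  -- v i up to sign.
  refine ⟨(updateRow 1 i v).submatrix (Equiv.swap 0 i) id, ?_, ?_⟩
  · rw [det_permute, ← cramer_transpose_apply, transpose_one, cramer_one]
    refine IsUnit.mul ?_ (isUnit_iff_ne_zero.2 hi)
    exact ((Equiv.Perm.sign (Equiv.swap 0 i)).map (Int.castRingHom F).toMonoidHom).isUnit
  · ext j
    simp

/-- The block diagonal matrix `diag(1, g)`. -/
def oneCons {k : ℕ} (g : Matrix (Fin k) (Fin k) F) : Matrix (Fin (k + 1)) (Fin (k + 1)) F :=
  of (Fin.cons (Fin.cons 1 0) fun i => Fin.cons 0 (g i))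

section Entries

variable {k : ℕ} (g : Matrix (Fin k) (Fin k) F)

@[simp] theorem oneCons_zero_zero : oneCons g 0 0 = 1 := rfl

@[simp] theorem oneCons_zero_succ (j : Fin k) : oneCons g 0 j.succ = 0 := rfl

@[simp] theorem oneCons_succ_zero (i : Fin k) : oneCons g i.succ 0 = 0 := rfl

@[simp] theorem oneCons_succ_succ (i j : Fin k) : oneCons g i.succ j.succ = g i j := rfl

theorem det_oneCons : (oneCons g).det = g.det := by
  rw [det_succ_row_zero, Fin.sum_univ_succ]
  simp
  rfl

theorem oneCons_congruence (v : Fin k → F) (M : Matrix (Fin k) (Fin k) F) :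
    (oneCons g)ᵀ * altCons v M * oneCons g = altCons (v ᵥ* g) (gᵀ * M * g) := by
  ext i j
  induction i using Fin.cases <;> induction j using Fin.cases <;>
    simp [Matrix.mul_apply, Fin.sum_univ_succ, vecMul, dotProduct, mul_comm]

end Entries

theorem isUnit_det_altCons_vecMul_iff {k : ℕ} {g : Matrix (Fin k) (Fin k) F} (hg : IsUnit g.det)
    (v : Fin k → F) (M : Matrix (Fin k) (Fin k) F) :
    IsUnit (altCons (v ᵥ* g) (gᵀ * M * g)).det ↔ IsUnit (altCons v M).det := by
  rw [← oneCons_congruence, det_mul, det_mul, det_transpose, det_oneCons]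
  simp [isUnit_iff_ne_zero.1 hg]

/-- Congruence by a nonsingular matrix permutes the alternating matrices. -/
noncomputable def altCongrEquiv {k : ℕ} {g : Matrix (Fin k) (Fin k) F} (hg : IsUnit g.det) :
    {M : Matrix (Fin k) (Fin k) F // IsAlternating M} ≃
      {M : Matrix (Fin k) (Fin k) F // IsAlternating M} where
  toFun M := ⟨gᵀ * M.1 * g, M.2.congruence g⟩
  invFun M := ⟨(g⁻¹)ᵀ * M.1 * g⁻¹, M.2.congruence g⁻¹⟩
  left_inv M := by
    have h : g⁻¹ᵀ * gᵀ = 1 := by rw [← transpose_mul, mul_nonsing_inv g hg, transpose_one]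
    refine Subtype.ext ?_
    calc g⁻¹ᵀ * (gᵀ * M.1 * g) * g⁻¹ = (g⁻¹ᵀ * gᵀ) * M.1 * (g * g⁻¹) := by
          simp only [Matrix.mul_assoc]
      _ = M.1 := by rw [h, mul_nonsing_inv g hg, Matrix.one_mul, Matrix.mul_one]
  right_inv M := by
    have h : gᵀ * g⁻¹ᵀ = 1 := by rw [← transpose_mul, nonsing_inv_mul g hg, transpose_one]
    refine Subtype.ext ?_
    calc gᵀ * (g⁻¹ᵀ * M.1 * g⁻¹) * g = (gᵀ * g⁻¹ᵀ) * M.1 * (g⁻¹ * g) := by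
          simp only [Matrix.mul_assoc]
      _ = M.1 := by rw [h, nonsing_inv_mul g hg, Matrix.one_mul, Matrix.mul_one]

/-- Expanding along the first row and then the first column leaves only M, so w is arbitrary. -/
theorem isUnit_det_altCons_single_iff {k : ℕ} (w : Fin k → F) (M : Matrix (Fin k) (Fin k) F) :
    IsUnit (altCons (Pi.single 0 1) (altCons w M)).det ↔ IsUnit M.det := by
  have : (altCons (Pi.single 0 1) (altCons w M)).det = M.det := by
    have h01 : altCons (Pi.single 0 1) (altCons w M) 0 1 = 1 := altCons_zero_succ _ _ 0
    have h10 : altCons (Pi.single 0 1) (altCons w M) 1 0 = -1 := altCons_succ_zero _ _ 0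
    have hM : (altCons (Pi.single 0 1) (altCons w M)).submatrix (Fin.succ ∘ Fin.succ)
        (Fin.succAbove 1 ∘ Fin.succ) = M := by
      ext i j
      simp
    rw [det_succ_row_zero, Fin.sum_univ_succ, Fin.sum_univ_succ]
    simp
    rw [det_succ_column_zero, Fin.sum_univ_succ]
    simp [h01, h10, hM]
  rw [this]

theorem not_isUnit_det_altCons_zero {k : ℕ} (M : Matrix (Fin k) (Fin k) F) :
    ¬ IsUnit (altCons 0 M).det := by
  rw [det_eq_zero_of_row_eq_zero 0]
  · simp
  · intro j
    induction j using Fin.cases <;> simp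

/-- Congruence by diag(1, g), with v as the top row of g, reduces to the first row (0, 1, 0, …, 0).
The next row then has k free entries, and the remaining block must be nonsingular. -/
theorem card_nonsingular_altCons {k : ℕ} {v : Fin (k + 1) → F} (hv : v ≠ 0) [Fintype F] :
    Nat.card {M : {M : Matrix (Fin (k + 1)) (Fin (k + 1)) F // IsAlternating M} //
      IsUnit (altCons v M.1).det} = Fintype.card F ^ k * numNonsingAlt F k := by
  obtain ⟨g, hg, rfl⟩ := exists_det_ne_zero_row_zero hv
  have hrow : g 0 = Pi.single 0 1 ᵥ* g := by simp; rfl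
  have h1 : Nat.card {M : {M : Matrix (Fin (k + 1)) (Fin (k + 1)) F // IsAlternating M} //
      IsUnit (altCons (Pi.single 0 1) M.1).det} = Fintype.card F ^ k * numNonsingAlt F k := by
    rw [← Nat.card_congr ((altConsEquiv F k).subtypeEquiv
      (p := fun p => IsUnit p.2.1.det) fun p => (isUnit_det_altCons_single_iff _ _).symm)]
    have e : {p : (Fin k → F) × {M : Matrix (Fin k) (Fin k) F // IsAlternating M} //
        IsUnit p.2.1.det} ≃ (Fin k → F) × {M : Matrix (Fin k) (Fin k) F //
          IsAlternating M ∧ IsUnit M.det} :=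
      { toFun := fun p => (p.1.1, ⟨p.1.2.1, p.1.2.2, p.2⟩)
        invFun := fun p => ⟨(p.1, ⟨p.2.1, p.2.2.1⟩), p.2.2.2⟩
        left_inv := fun _ => rfl
        right_inv := fun _ => rfl }
    rw [Nat.card_congr e, Nat.card_prod, numNonsingAlt]
    simp
  rw [← h1]
  refine (Nat.card_congr ((altCongrEquiv hg).subtypeEquiv fun M => ?_)).symm
  rw [hrow]
  exact (isUnit_det_altCons_vecMul_iff hg _ _).symm

theorem numNonsingAlt_zero : numNonsingAlt F 0 = 1 := by
  have : Unique {M : Matrix (Fin 0) (Fin 0) F // IsAlternating M ∧ IsUnit M.det} :=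
    { default := ⟨0, ⟨fun i => i.elim0, fun i => i.elim0⟩, by simp⟩
      uniq := fun M => Subtype.ext (Subsingleton.elim _ _) }
  rw [numNonsingAlt, Nat.card_unique]

/-- Sort by the first row: zero contributes nothing, and every nonzero row contributes equally. -/
theorem numNonsingAlt_add_two [Fintype F] (k : ℕ) :
    numNonsingAlt F (k + 2) =
      (Fintype.card F ^ (k + 1) - 1) * (Fintype.card F ^ k * numNonsingAlt F k) := by
  classical
  have e1 : {M : Matrix (Fin (k + 2)) (Fin (k + 2)) F // IsAlternating M ∧ IsUnit M.det} ≃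
      Σ v : Fin (k + 1) → F, {M : {M : Matrix (Fin (k + 1)) (Fin (k + 1)) F // IsAlternating M} //
        IsUnit (altCons v M.1).det} :=
    (Equiv.subtypeSubtypeEquivSubtypeInter _ _).symm.trans <|
      ((altConsEquiv F (k + 1)).subtypeEquiv
        (p := fun p => IsUnit (altCons p.1 p.2.1).det) fun _ => Iff.rfl).symm.trans
      { toFun := fun p => ⟨p.1.1, p.1.2, p.2⟩
        invFun := fun p => ⟨(p.1, p.2.1), p.2.2⟩
        left_inv := fun _ => rfl
        right_inv := fun _ => rfl }
  rw [numNonsingAlt, Nat.card_congr e1, Nat.card_sigma,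
    ← Finset.add_sum_erase _ _ (Finset.mem_univ 0)]
  have h0 : IsEmpty {M : {M : Matrix (Fin (k + 1)) (Fin (k + 1)) F // IsAlternating M} //
      IsUnit (altCons 0 M.1).det} := ⟨fun M => not_isUnit_det_altCons_zero _ M.2⟩
  rw [Nat.card_of_isEmpty, zero_add, Finset.sum_congr rfl fun v hv =>
    card_nonsingular_altCons (Finset.ne_of_mem_erase hv), Finset.sum_const,
    Finset.card_erase_of_mem (Finset.mem_univ _)]
  simp

theorem numNonsingAlt_two_mul [Fintype F] (m : ℕ) :
    (numNonsingAlt F (2 * m) : ℂ) = (Fintype.card F : ℂ) ^ (m * (m - 1)) *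
      ∏ j ∈ Finset.Icc 1 m, ((Fintype.card F : ℂ) ^ (2 * j - 1) - 1) := by
  induction m with
  | zero => simp [numNonsingAlt_zero]
  | succ m ih =>
    have hq : 1 ≤ Fintype.card F ^ (2 * m + 1) := Nat.one_le_pow _ _ Fintype.card_pos
    have he : (m + 1) * (m + 1 - 1) = m * (m - 1) + 2 * m := by
      cases m <;> simp; ring
    rw [show 2 * (m + 1) = 2 * m + 2 by ring, numNonsingAlt_add_two, Finset.prod_Icc_succ_top
      (by omega), show 2 * (m + 1) - 1 = 2 * m + 1 by omega, he, Nat.cast_mul, Nat.cast_sub hq]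
    push_cast
    rw [ih]
    ring

end AlternatingCount

/-! ### Class sums over a double coset. -/

section DoubleCosetSum

open Finset

variable {M : Type*} [Monoid M] [DecidableEq M]

/-- A sum over the double coset `H s H`, for a finite subgroup `H` of the units of a monoid and an
involution `s`, of a function `f` with `f (x * y) = f (y * x)`. -/
theorem card_mul_sum_doubleCoset (H : Finset M) (hmul : ∀ x ∈ H, ∀ y ∈ H, x * y ∈ H)
    (hinv : ∀ x ∈ H, ∃ y ∈ H, x * y = 1 ∧ y * x = 1) (s : M) (hs : s * s = 1) (f : M → ℂ)
    (hf : ∀ x y, f (x * y) = f (y * x)) (D : Finset M)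
    (hD : ∀ w, w ∈ D ↔ ∃ x ∈ H, ∃ y ∈ H, w = x * s * y) :
    ((#{x ∈ H | s * x * s ∈ H} : ℕ) : ℂ) * ∑ w ∈ D, f w = #H * ∑ x ∈ H, f (x * s) := by
  -- All fibres of (x, y) ↦ x s y have the same size: over p s p', the map (x, y) ↦ p⁻¹x is a
  -- bijection onto H ∩ sHs, with inverse x ↦ (px, (sxs)⁻¹p').
  have hfiber : ∀ w ∈ D, #{p ∈ H ×ˢ H | p.1 * s * p.2 = w} = #{x ∈ H | s * x * s ∈ H} := by
    intro w hw
    obtain ⟨p, hp, p', hp', rfl⟩ := (hD w).1 hw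
    obtain ⟨u, hu, hpu, hup⟩ := hinv p hp
    obtain ⟨u', hu', hpu', hup'⟩ := hinv p' hp'
    refine card_bij (fun x _ => u * x.1) ?_ ?_ ?_
    · rintro ⟨x, y⟩ h
      simp only [mem_filter, mem_product] at h ⊢
      obtain ⟨⟨hx, hy⟩, hxy⟩ := h
      refine ⟨hmul u hu x hx, ?_⟩
      obtain ⟨z, hz, hyz, hzy⟩ := hinv y hy
      have : s * (u * x) * s = p' * z := by
        calc s * (u * x) * s = s * u * (x * s * y) * z := by
              simp only [mul_assoc, hyz, mul_one]
          _ = s * (u * p) * s * p' * z := by rw [hxy]; simp only [mul_assoc]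
          _ = p' * z := by rw [hup, mul_one, hs, one_mul]
      rw [this]
      exact hmul p' hp' z hz
    · rintro ⟨x, y⟩ h ⟨x', y'⟩ h' hxx
      simp only [mem_filter, mem_product] at h h' hxx
      have h1 : x = x' := by
        rw [← one_mul x, ← hpu, mul_assoc, hxx, ← mul_assoc, hpu, one_mul]
      subst h1
      obtain ⟨z, hz, hxz, hzx⟩ := hinv x h.1.1
      have h2 : ∀ v, s * z * (x * s * v) = v := fun v => by
        calc s * z * (x * s * v) = s * (z * x) * s * v := by simp only [mul_assoc]
          _ = v := by rw [hzx, mul_one, hs, one_mul]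
      rw [Prod.mk.injEq]
      exact ⟨rfl, by rw [← h2 y, h.2, ← h'.2, h2]⟩
    · intro x hx
      simp only [mem_filter] at hx
      obtain ⟨z, hz, hxz, hzx⟩ := hinv _ hx.2
      refine ⟨(p * x, z * p'), ?_, ?_⟩
      · simp only [mem_filter, mem_product]
        refine ⟨⟨hmul p hp x hx.1, hmul z hz p' hp'⟩, ?_⟩
        calc p * x * s * (z * p') = p * (s * s) * x * s * z * p' := by
              simp only [hs, mul_assoc, mul_one]
          _ = p * s * (s * x * s * z) * p' := by simp only [mul_assoc]
          _ = p * s * p' := by rw [hxz, mul_one]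
      · simp only [← mul_assoc, hup, one_mul]
  have h1 : ∑ p ∈ H ×ˢ H, f (p.1 * s * p.2) =
      ((#{x ∈ H | s * x * s ∈ H} : ℕ) : ℂ) * ∑ w ∈ D, f w := by
    rw [← sum_fiberwise_of_maps_to (t := D) (g := fun p => p.1 * s * p.2), mul_sum]
    · refine sum_congr rfl fun w hw => ?_
      rw [sum_congr rfl fun p hp => by rw [(mem_filter.1 hp).2], sum_const, hfiber w hw,
        nsmul_eq_mul]
    · intro p hp
      rw [mem_product] at hp
      exact (hD _).2 ⟨p.1, hp.1, p.2, hp.2, rfl⟩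
  -- For fixed y, f(xsy) = f(yxs), and yx runs over H.
  rw [← h1, sum_product_right, ← nsmul_eq_mul, ← sum_const]
  refine sum_congr rfl fun y hy => ?_
  obtain ⟨z, hz, hyz, hzy⟩ := hinv y hy
  refine sum_bij (fun x _ => y * x) (fun x hx => hmul y hy x hx) (fun x _ x' _ h => ?_)
    (fun x hx => ⟨z * x, hmul z hz x hx, by rw [← mul_assoc, hyz, one_mul]⟩) fun x _ => ?_
  · rw [← one_mul x, ← hzy, mul_assoc, h, ← mul_assoc, hzy, one_mul]
  · rw [hf, mul_assoc]

end DoubleCosetSum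

/-! ### The parabolic subgroup as a stabilizer. -/

section Parabolic

open Matrix

variable {F : Type*} [Field F] {n : ℕ}

theorem levi_mul_unip (A : GL (Fin n) F) (B : Matrix (Fin n) (Fin n) F)
    (h : Matrix Unit (Fin n) F) :
    levi A * unip B h = fromBlocks (fromBlocks (A : Matrix (Fin n) (Fin n) F)
      ((A : Matrix (Fin n) (Fin n) F) * B) 0
      ((A⁻¹ : GL (Fin n) F) : Matrix (Fin n) (Fin n) F)ᵀ) 0 (fromCols 0 h) 1 := by
  simp [levi, unip, fromBlocks_multiply]

theorem isAlternating_of_dotProduct_mulVec_self {M : Matrix (Fin n) (Fin n) F}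
    (hM : ∀ v, v ⬝ᵥ (M *ᵥ v) = 0) : IsAlternating M := by
  have hd : ∀ i, M i i = 0 := fun i => by simpa using hM (Pi.single i 1)
  refine ⟨hd, fun i j => ?_⟩
  have := hM (Pi.single i 1 + Pi.single j 1)
  simp [mulVec_add, hd] at this
  linear_combination this

theorem eq_zero_of_dotProduct_eq_zero {v : Fin n → F} (h : ∀ u, u ⬝ᵥ v = 0) : v = 0 :=
  funext fun i => by simpa using h (Pi.single i 1)

theorem mulVec_const_unit {m : Type*} (y : Matrix m Unit F) (t : F) :
    (y *ᵥ fun _ => t) = t • fun i => y i () := by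
  ext i
  simp [mulVec, dotProduct, mul_comm]

/-- Special vectors separate the isometry identity: the mixed u, v terms give AᵀD = 1, the terms
with t kill z and y and give c² = 1, and the purely v-quadratic part says that DᵀX + hᵀh is
alternating. -/
theorem mem_P_of_isometry [CharP F 2] {A X D : Matrix (Fin n) (Fin n) F} {y z : Fin n → F}
    {h : Matrix Unit (Fin n) F} {c : F}
    (hiso : ∀ (u v : Fin n → F) (t : F), (A *ᵥ u + X *ᵥ v + t • y) ⬝ᵥ (D *ᵥ v + t • z) +
      ((h *ᵥ v) () + t * c) ^ 2 = u ⬝ᵥ v + t ^ 2) :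
    y = 0 ∧ z = 0 ∧ c = 1 ∧ ∃ (A' : GL (Fin n) F) (B : Matrix (Fin n) (Fin n) F),
      IsAlternating (B + hᵀ * h) ∧ (A' : Matrix (Fin n) (Fin n) F) = A ∧
        ((A'⁻¹ : GL (Fin n) F) : Matrix (Fin n) (Fin n) F)ᵀ = D ∧ A * B = X := by
  have h1 : y ⬝ᵥ z + c ^ 2 = 1 := by simpa using hiso 0 0 1
  have hX : ∀ v, (X *ᵥ v) ⬝ᵥ (D *ᵥ v) + (h *ᵥ v) () ^ 2 = 0 := fun v => by
    simpa using hiso 0 v 0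
  have hAz : ∀ u, u ⬝ᵥ (Aᵀ *ᵥ z) = 0 := fun u => by
    have := hiso u 0 1
    simp [add_dotProduct] at this
    rw [dotProduct_mulVec, vecMul_transpose]
    linear_combination this - h1
  have hAD : Aᵀ * D = 1 := by
    refine ext_of_mulVec_single fun i => ?_
    rw [← sub_eq_zero]
    refine eq_zero_of_dotProduct_eq_zero fun u => ?_
    have h2 := hiso u (Pi.single i 1) 0
    have h3 := hX (Pi.single i 1)
    rw [dotProduct_sub, ← mulVec_mulVec, dotProduct_mulVec u, vecMul_transpose, one_mulVec]
    simp only [zero_smul, add_zero, add_dotProduct, zero_mul] at h2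
    linear_combination h2 - h3
  have hDA : D * Aᵀ = 1 := mul_eq_one_comm.1 hAD
  have hz : z = 0 := by
    rw [← one_mulVec z, ← hDA, ← mulVec_mulVec, eq_zero_of_dotProduct_eq_zero hAz, mulVec_zero]
  have hc : c = 1 := by
    rw [hz, dotProduct_zero, zero_add] at h1
    have : (c + 1) ^ 2 = 0 := by rw [CharTwo.add_sq, h1, one_pow, CharTwo.add_self_eq_zero]
    exact CharTwo.add_eq_zero.1 (pow_eq_zero_iff two_ne_zero |>.1 this)
  have hDy : ∀ v, v ⬝ᵥ (Dᵀ *ᵥ y) = 0 := fun v => by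
    have h2 := hiso 0 v 1
    have h3 := hX v
    simp [add_dotProduct, hz, hc, CharTwo.add_sq] at h2
    rw [dotProduct_mulVec, vecMul_transpose, dotProduct_comm]
    linear_combination h2 - h3
  have hAD' : A * Dᵀ = 1 := by simpa using congrArg transpose hDA
  have hDA' : Dᵀ * A = 1 := by simpa using congrArg transpose hAD
  have hy : y = 0 := by
    rw [← one_mulVec y, ← hAD', ← mulVec_mulVec, eq_zero_of_dotProduct_eq_zero hDy, mulVec_zero]
  refine ⟨hy, hz, hc, ⟨A, Dᵀ, hAD', hDA'⟩, Dᵀ * X, ?_, rfl, transpose_transpose D, ?_⟩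
  · refine isAlternating_of_dotProduct_mulVec_self fun v => ?_
    rw [← hX v, add_mulVec, dotProduct_add, ← mulVec_mulVec, ← mulVec_mulVec, dotProduct_mulVec,
      dotProduct_mulVec v hᵀ, vecMul_transpose, vecMul_transpose, dotProduct_comm]
    simp [dotProduct, sq]
  · rw [← Matrix.mul_assoc, hAD', Matrix.one_mul]

/-- `P` is the stabilizer in the isometry group of the span of the first `n` basis vectors. -/
theorem mem_P_iff [CharP F 2] {w : Matrix (Idx n) (Idx n) F} :
    w ∈ P F n ↔ w ∈ O F n ∧ ∀ u, ∃ u',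
      w *ᵥ Sum.elim (Sum.elim u (0 : Fin n → F)) (0 : Unit → F) =
        Sum.elim (Sum.elim u' (0 : Fin n → F)) (0 : Unit → F) := by
  constructor
  · intro hw
    refine ⟨P_subset_O F n hw, fun u => ?_⟩
    obtain ⟨A, B, h, -, rfl⟩ := hw
    refine ⟨(A : Matrix (Fin n) (Fin n) F) *ᵥ u, ?_⟩
    ext i
    rcases i with (i | i) | i <;>
      simp [levi_mul_unip, fromBlocks_mulVec, fromCols_mulVec, Function.comp_def, ← Pi.zero_def]
  · rintro ⟨⟨-, hiso⟩, hstab⟩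
    obtain ⟨A, X, C, D, y, z, g, h, c, rfl⟩ : ∃ (A X C D : Matrix (Fin n) (Fin n) F)
        (y z : Matrix (Fin n) Unit F) (g h : Matrix Unit (Fin n) F) (c : Matrix Unit Unit F),
        w = fromBlocks (fromBlocks A X C D) (fromRows y z) (fromCols g h) c :=
      ⟨w.toBlocks₁₁.toBlocks₁₁, w.toBlocks₁₁.toBlocks₁₂, w.toBlocks₁₁.toBlocks₂₁,
        w.toBlocks₁₁.toBlocks₂₂, w.toBlocks₁₂.toRows₁, w.toBlocks₁₂.toRows₂,
        w.toBlocks₂₁.toCols₁, w.toBlocks₂₁.toCols₂, w.toBlocks₂₂, by simp [fromBlocks_toBlocks]⟩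
    have hmul : ∀ u v t, fromBlocks (fromBlocks A X C D) (fromRows y z) (fromCols g h) c *ᵥ
        Sum.elim (Sum.elim u v) t = Sum.elim (Sum.elim (A *ᵥ u + X *ᵥ v + y *ᵥ t)
          (C *ᵥ u + D *ᵥ v + z *ᵥ t)) (g *ᵥ u + h *ᵥ v + c *ᵥ t) := by
      intro u v t
      ext i
      rcases i with (i | i) | i <;>
        simp [fromBlocks_mulVec, fromCols_mulVec, fromRows_mulVec, Function.comp_def]
    have hCg : ∀ u, C *ᵥ u = 0 ∧ g *ᵥ u = 0 := fun u => by
      obtain ⟨u', hu'⟩ := hstab u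
      rw [hmul] at hu'
      simp [Sum.elim_eq_iff] at hu'
      exact ⟨hu'.1.2, hu'.2⟩
    have hC : C = 0 := ext_of_mulVec_single fun i => by rw [(hCg _).1, zero_mulVec]
    have hg : g = 0 := ext_of_mulVec_single fun i => by rw [(hCg _).2, zero_mulVec]
    subst hC hg
    obtain ⟨hy, hz, hc, A', B, hB, rfl, rfl, rfl⟩ := mem_P_of_isometry (A := A) (X := X) (D := D)
      (y := fun i => y i ()) (z := fun i => z i ()) (h := h) (c := c () ()) fun u v t => by
        have := hiso (Sum.elim (Sum.elim u v) fun _ => t)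
        rw [hmul, theta_elim, theta_elim] at this
        simpa [mulVec_const_unit] using this
    refine ⟨A', B, h, hB, ?_⟩
    rw [levi_mul_unip]
    have hy0 : y = 0 := by ext i j; exact congrFun hy i
    have hz0 : z = 0 := by ext i j; exact congrFun hz i
    have hc0 : c = 1 := by ext i j; simpa using hc
    subst hy0 hz0 hc0
    simp

theorem one_mem_O : (1 : Matrix (Idx n) (Idx n) F) ∈ O F n := ⟨isUnit_one, fun x => by simp⟩

theorem mul_mem_O {w w' : Matrix (Idx n) (Idx n) F} (hw : w ∈ O F n) (hw' : w' ∈ O F n) :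
    w * w' ∈ O F n :=
  ⟨hw.1.mul hw'.1, fun x => by rw [← mulVec_mulVec, hw.2, hw'.2]⟩

variable [CharP F 2]

theorem one_mem_P : (1 : Matrix (Idx n) (Idx n) F) ∈ P F n :=
  mem_P_iff.2 ⟨one_mem_O, fun u => ⟨u, by simp⟩⟩

theorem mul_mem_P {w w' : Matrix (Idx n) (Idx n) F} (hw : w ∈ P F n) (hw' : w' ∈ P F n) :
    w * w' ∈ P F n := by
  rw [mem_P_iff] at *
  refine ⟨mul_mem_O hw.1 hw'.1, fun u => ?_⟩
  obtain ⟨u', hu'⟩ := hw'.2 u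
  obtain ⟨u'', hu''⟩ := hw.2 u'
  exact ⟨u'', by rw [← mulVec_mulVec, hu', hu'']⟩

/-- In a finite group the inverse is a power, so closure under products suffices. -/
theorem exists_inv_mem_P [Finite F] {w : Matrix (Idx n) (Idx n) F} (hw : w ∈ P F n) :
    ∃ w' ∈ P F n, w * w' = 1 ∧ w' * w = 1 := by
  obtain ⟨g, rfl⟩ := (P_subset_O F n hw).1
  have hpow : ∀ k : ℕ, (g : Matrix (Idx n) (Idx n) F) ^ k ∈ P F n := fun k => by
    induction k with
    | zero => exact one_mem_P
    | succ k ih => rw [pow_succ]; exact mul_mem_P ih hw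
  obtain ⟨k, hk, hgk⟩ := (isOfFinOrder_of_finite g).exists_pow_eq_one
  have h1 : (g : Matrix (Idx n) (Idx n) F) ^ (k - 1 + 1) = 1 := by
    rw [Nat.sub_add_cancel hk, ← Units.val_pow_eq_pow_val, hgk, Units.val_one]
  exact ⟨_, hpow (k - 1), by rw [← pow_succ', h1], by rw [← pow_succ, h1]⟩

end Parabolic

/-! ### Splitting off the last coordinate in GL. -/

section LastBlock

open Matrix

variable {F : Type*} {k : ℕ}

/-- The block matrix with block rows `(M, c)` and `(w, d)`. -/
def snocMat (M : Matrix (Fin k) (Fin k) F) (c w : Fin k → F) (d : F) :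
    Matrix (Fin (k + 1)) (Fin (k + 1)) F :=
  of fun i j => Fin.lastCases (Fin.lastCases d w j) (fun i' => Fin.lastCases (c i') (M i') j) i

section Entries

variable (M : Matrix (Fin k) (Fin k) F) (c w : Fin k → F) (d : F)

@[simp] theorem snocMat_castSucc_castSucc (i j : Fin k) :
    snocMat M c w d i.castSucc j.castSucc = M i j := by simp [snocMat]

@[simp] theorem snocMat_castSucc_last (i : Fin k) :
    snocMat M c w d i.castSucc (Fin.last k) = c i := by simp [snocMat]

@[simp] theorem snocMat_last_castSucc (j : Fin k) :
    snocMat M c w d (Fin.last k) j.castSucc = w j := by simp [snocMat]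

@[simp] theorem snocMat_last_last : snocMat M c w d (Fin.last k) (Fin.last k) = d := by
  simp [snocMat]

end Entries

theorem ext_last {M N : Matrix (Fin (k + 1)) (Fin (k + 1)) F}
    (h11 : ∀ i j : Fin k, M i.castSucc j.castSucc = N i.castSucc j.castSucc)
    (h12 : ∀ i : Fin k, M i.castSucc (Fin.last k) = N i.castSucc (Fin.last k))
    (h21 : ∀ j : Fin k, M (Fin.last k) j.castSucc = N (Fin.last k) j.castSucc)
    (h22 : M (Fin.last k) (Fin.last k) = N (Fin.last k) (Fin.last k)) : M = N := by
  ext i j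
  induction i using Fin.lastCases <;> induction j using Fin.lastCases
  exacts [h22, h21 _, h12 _, h11 _ _]

variable [Field F]

theorem snocMat_mul (M M' : Matrix (Fin k) (Fin k) F) (w w' : Fin k → F) (d d' : F) :
    snocMat M 0 w d * snocMat M' 0 w' d' = snocMat (M * M') 0 (w ᵥ* M' + d • w') (d * d') := by
  apply ext_last <;> intros <;> simp [Matrix.mul_apply, Fin.sum_univ_castSucc, vecMul, dotProduct]

theorem snocMat_one : snocMat (1 : Matrix (Fin k) (Fin k) F) 0 0 1 = 1 := by
  apply ext_last <;> intros <;> simp [Matrix.one_apply, Fin.castSucc_ne_last, (Fin.castSucc_ne_last _).symm]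

/-- The invertible block matrix with block rows `(A, 0)` and `(w, d)`. -/
def lowerGL (A : GL (Fin k) F) (w : Fin k → F) (d : Fˣ) : GL (Fin (k + 1)) F :=
  have h : snocMat (A : Matrix (Fin k) (Fin k) F) 0 w d *
      snocMat ((A⁻¹ : GL (Fin k) F) : Matrix (Fin k) (Fin k) F) 0
        (-(((d⁻¹ : Fˣ) : F) • (w ᵥ* ((A⁻¹ : GL (Fin k) F) : Matrix (Fin k) (Fin k) F))))
        ((d⁻¹ : Fˣ) : F) = 1 := by
    rw [snocMat_mul, ← snocMat_one, ← Units.val_mul, ← Units.val_mul, mul_inv_cancel,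
      mul_inv_cancel, smul_neg, smul_smul, ← Units.val_mul, mul_inv_cancel, Units.val_one, Units.val_one, one_smul,
      add_neg_cancel]
  ⟨_, _, h, mul_eq_one_comm.1 h⟩

theorem coe_lowerGL (A : GL (Fin k) F) (w : Fin k → F) (d : Fˣ) :
    (lowerGL A w d : Matrix (Fin (k + 1)) (Fin (k + 1)) F) =
      snocMat (A : Matrix (Fin k) (Fin k) F) 0 w d := rfl

theorem coe_lowerGL_inv (A : GL (Fin k) F) (w : Fin k → F) (d : Fˣ) :
    (((lowerGL A w d)⁻¹ : GL (Fin (k + 1)) F) : Matrix (Fin (k + 1)) (Fin (k + 1)) F) =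
      snocMat ((A⁻¹ : GL (Fin k) F) : Matrix (Fin k) (Fin k) F) 0
        (-(((d⁻¹ : Fˣ) : F) • (w ᵥ* ((A⁻¹ : GL (Fin k) F) : Matrix (Fin k) (Fin k) F))))
        ((d⁻¹ : Fˣ) : F) := rfl

/-- The last column vanishes except possibly for its last entry. -/
def LastColZero (A : Matrix (Fin (k + 1)) (Fin (k + 1)) F) : Prop :=
  ∀ i : Fin k, A i.castSucc (Fin.last k) = 0

/-- Invertible matrices whose last column vanishes above the last entry. -/
def lowerEquiv (F : Type*) [Field F] (k : ℕ) : GL (Fin k) F × (Fin k → F) × Fˣ ≃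
    {A : GL (Fin (k + 1)) F // LastColZero (A : Matrix (Fin (k + 1)) (Fin (k + 1)) F)} where
  toFun p := ⟨lowerGL p.1 p.2.1 p.2.2, fun i => by simp [coe_lowerGL]⟩
  invFun A :=
    have h1 : (A.1 : Matrix (Fin (k + 1)) (Fin (k + 1)) F).submatrix Fin.castSucc Fin.castSucc *
        (A.1⁻¹.1 : Matrix (Fin (k + 1)) (Fin (k + 1)) F).submatrix Fin.castSucc Fin.castSucc =
          1 := by
      ext i j
      have := congrFun (congrFun (Units.mul_inv A.1) i.castSucc) j.castSucc
      rw [Matrix.mul_apply, Fin.sum_univ_castSucc, A.2 i, zero_mul, add_zero] at this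
      rw [Matrix.mul_apply]
      refine this.trans ?_
      simp [Matrix.one_apply]
    have h2 : (A.1⁻¹.1 : Matrix (Fin (k + 1)) (Fin (k + 1)) F) (Fin.last k) (Fin.last k) *
        (A.1 : Matrix (Fin (k + 1)) (Fin (k + 1)) F) (Fin.last k) (Fin.last k) = 1 := by
      have := congrFun (congrFun (Units.inv_mul A.1) (Fin.last k)) (Fin.last k)
      rw [Matrix.mul_apply, Fin.sum_univ_castSucc] at this
      simpa [A.2 _] using this
    (⟨_, _, h1, mul_eq_one_comm.1 h1⟩,
      fun j => (A.1 : Matrix (Fin (k + 1)) (Fin (k + 1)) F) (Fin.last k) j.castSucc,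
      ⟨_, _, (mul_comm _ _).trans h2, h2⟩)
  left_inv p := by
    refine Prod.ext (Units.ext ?_) (Prod.ext ?_ (Units.ext ?_))
    · ext i j
      simp [coe_lowerGL]
    · ext j
      simp [coe_lowerGL]
    · simp [coe_lowerGL]
  right_inv A := by
    refine Subtype.ext (Units.ext ?_)
    rw [coe_lowerGL]
    apply ext_last <;> intros <;> simp [A.2 _]

theorem lowerEquiv_apply (A : GL (Fin k) F) (w : Fin k → F) (d : Fˣ) :
    (lowerEquiv F k (A, w, d)).1 = lowerGL A w d := rfl

theorem card_GL_succ (F : Type*) [Field F] [Fintype F] (k : ℕ) :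
    Nat.card (GL (Fin (k + 1)) F) = (Fintype.card F ^ (k + 1) - 1) *
      (Fintype.card F ^ k * Nat.card (GL (Fin k) F)) := by
  rw [Matrix.card_GL_field, Matrix.card_GL_field, Fin.prod_univ_succ]
  -- Each factor after the first of the product for |GL_{k+1}| is q times a factor for |GL_k|.
  have : ∀ i : Fin k, Fintype.card F ^ (k + 1) - Fintype.card F ^ (i.succ : ℕ) =
      Fintype.card F * (Fintype.card F ^ k - Fintype.card F ^ (i : ℕ)) := fun i => by
    rw [Nat.mul_sub, Fin.val_succ, pow_succ', pow_succ']
  rw [Finset.prod_congr rfl fun i _ => this i, Finset.prod_mul_distrib]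
  simp

end LastBlock

/-! ### The unipotent radical of P. -/

section Unipotent

open Matrix

variable {F : Type*} [Field F] [CharP F 2] {n k : ℕ}

/-- Signs disappear in characteristic 2, and hᵀh is symmetric with diagonal h_i². This form of the
condition is visibly additive in (B, h), as squaring is. -/
theorem isAlternating_add_transpose_mul_iff {B : Matrix (Fin n) (Fin n) F}
    {h : Matrix Unit (Fin n) F} :
    IsAlternating (B + hᵀ * h) ↔ (∀ i, B i i = h () i ^ 2) ∧ ∀ i j, B i j = B j i := by
  simp only [IsAlternating, Matrix.add_apply, mul_apply, transpose_apply, Finset.univ_unique,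
    Finset.sum_singleton, CharTwo.neg_eq]
  refine and_congr (forall_congr' fun i => ?_) (forall₂_congr fun i j => ?_)
  · rw [CharTwo.add_eq_zero, sq]
  · rw [mul_comm (h default j), add_left_inj]

/-- The parameters `(B, h)` of the unipotent radical of `P`. -/
def unipParam (F : Type*) [Field F] [CharP F 2] (n : ℕ) :
    AddSubgroup (Matrix (Fin n) (Fin n) F × Matrix Unit (Fin n) F) where
  carrier := {p | IsAlternating (p.1 + p.2ᵀ * p.2)}
  zero_mem' := by simp [IsAlternating]
  add_mem' {p p'} hp hp' := by
    simp only [Set.mem_ofPred_eq, isAlternating_add_transpose_mul_iff] at *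
    refine ⟨fun i => ?_, fun i j => ?_⟩
    · simp [hp.1 i, hp'.1 i, CharTwo.add_sq]
    · simp [hp.2 i j, hp'.2 i j]
  neg_mem' {p} hp := by
    simp only [Set.mem_ofPred_eq, isAlternating_add_transpose_mul_iff] at *
    refine ⟨fun i => ?_, fun i j => ?_⟩
    · simp [hp.1 i, CharTwo.neg_eq]
    · simp [hp.2 i j]

theorem mem_unipParam {p : Matrix (Fin n) (Fin n) F × Matrix Unit (Fin n) F} :
    p ∈ unipParam F n ↔ (∀ i, p.1 i i = p.2 () i ^ 2) ∧ ∀ i j, p.1 i j = p.1 j i :=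
  isAlternating_add_transpose_mul_iff

theorem card_unipParam (F : Type*) [Field F] [Fintype F] [CharP F 2] (n : ℕ) :
    Nat.card (unipParam F n) = Fintype.card F ^ (n * (n - 1) / 2 + n) := by
  -- Adding hᵀh is an involution, so (B, h) corresponds to a free alternating matrix and a free row.
  have key : ∀ (B : Matrix (Fin n) (Fin n) F) (h : Matrix Unit (Fin n) F),
      B + hᵀ * h + hᵀ * h = B := fun B h => by
    ext i j
    simp [add_assoc, CharTwo.add_self_eq_zero]
  have e : unipParam F n ≃
      {M : Matrix (Fin n) (Fin n) F // IsAlternating M} × Matrix Unit (Fin n) F :=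
    { toFun := fun p => (⟨p.1.1 + p.1.2ᵀ * p.1.2, p.2⟩, p.1.2)
      invFun := fun p => ⟨(p.1.1 + p.2ᵀ * p.2, p.2), by
        change IsAlternating _
        rw [key]
        exact p.1.2⟩
      left_inv := fun p => Subtype.ext (Prod.ext (key _ _) rfl)
      right_inv := fun p => Prod.ext (Subtype.ext (key _ _)) rfl }
  rw [Nat.card_congr e, Nat.card_prod, card_alternating, pow_add]
  congr 1
  simp [Matrix]

/-- Elements of the radical with vanishing upper left block of `B`. -/
theorem card_unipParam_block_zero (F : Type*) [Field F] [Fintype F] [CharP F 2] (k : ℕ) :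
    Nat.card {p : unipParam F (k + 1) // ∀ i j : Fin k, p.1.1 i.castSucc j.castSucc = 0} =
      Fintype.card F ^ (k + 1) := by
  have e : {p : unipParam F (k + 1) // ∀ i j : Fin k, p.1.1 i.castSucc j.castSucc = 0} ≃
      (Fin k → F) × F :=
    -- The zero block forces h_i² = B_ii = 0 for i < k; what survives is the last column of B above
    -- the corner and the last entry of h, whose square is the corner.
    { toFun := fun p => (fun i => p.1.1.1 i.castSucc (Fin.last k), p.1.1.2 () (Fin.last k))
      invFun := fun p => ⟨⟨(snocMat 0 p.1 p.1 (p.2 ^ 2), of fun _ => Fin.lastCases p.2 0), by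
        rw [mem_unipParam]
        refine ⟨fun i => ?_, fun i j => ?_⟩
        · induction i using Fin.lastCases <;> simp
        · induction i using Fin.lastCases <;> induction j using Fin.lastCases <;> simp⟩,
        fun i j => by simp⟩
      left_inv := fun p => by
        have hp := mem_unipParam.1 p.1.2
        refine Subtype.ext (Subtype.ext (Prod.ext ?_ ?_))
        · apply ext_last <;> intros <;> simp [p.2 _ _, hp.1 (Fin.last k), hp.2 (Fin.last k) _]
        · ext i j
          induction j using Fin.lastCases with
          | last => simp
          | cast j =>
            have := hp.1 j.castSucc
            rw [p.2 j j] at this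
            simpa using ((pow_eq_zero_iff two_ne_zero).1 this.symm).symm
      right_inv := fun p => by simp }
  rw [Nat.card_congr e, Nat.card_prod]
  simp [pow_succ]

/-- `P` is the product of its Levi factor and its unipotent radical. -/
noncomputable def paramEquiv (F : Type*) [Field F] [CharP F 2] (n : ℕ) :
    GL (Fin n) F × unipParam F n ≃ P F n :=
  Equiv.ofBijective (fun p => ⟨levi p.1 * unip p.2.1.1 p.2.1.2, p.1, p.2.1.1, p.2.1.2, p.2.2, rfl⟩) <| by
    constructor
    · rintro ⟨A, ⟨⟨B, h⟩, hp⟩⟩ ⟨A', ⟨⟨B', h'⟩, hp'⟩⟩ heq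
      have h1 := congrArg Subtype.val heq
      simp only [levi_mul_unip] at h1
      rw [fromBlocks_inj, fromBlocks_inj] at h1
      obtain ⟨⟨hA, hB, -⟩, -, hh, -⟩ := h1
      obtain rfl : A = A' := Units.ext hA
      obtain rfl : B = B' := by
        have := congrArg (((A⁻¹ : GL (Fin n) F) : Matrix (Fin n) (Fin n) F) * ·) hB
        simpa [← Matrix.mul_assoc] using this
      obtain rfl : h = h' := by
        have := congrArg toCols₂ hh
        simpa using this
      rfl
    · rintro ⟨_, A, B, h, hB, rfl⟩
      exact ⟨(A, ⟨(B, h), hB⟩), rfl⟩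

theorem coe_paramEquiv (A : GL (Fin n) F) (p : unipParam F n) :
    (paramEquiv F n (A, p) : Matrix (Idx n) (Idx n) F) = levi A * unip p.1.1 p.1.2 := rfl

end Unipotent

/-! ### The character sum over Pσ. -/

section CharacterSum

open Matrix

variable {F : Type*} [Field F] {n k : ℕ}

theorem trace_mul_eq_zero_of_alternating {M B : Matrix (Fin n) (Fin n) F} (hM : IsAlternating M)
    (hB : ∀ i j, B i j = B j i) : trace (M * B) = 0 := by
  simp only [trace, diag_apply, Matrix.mul_apply, ← Finset.sum_product']
  refine Finset.sum_involution (fun p _ => (p.2, p.1)) ?_ ?_ ?_ ?_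
  · rintro ⟨i, j⟩ _
    rw [hM.2 i j, hB j i]
    ring
  · rintro ⟨i, j⟩ _ hne h
    obtain rfl : j = i := congrArg Prod.fst h
    exact hne (by simp [hM.1])
  · simp
  · simp

/-- The pairs (s²E_ii, s e_i) detect the diagonal of M, since every c is a square, and the pairs
(c(E_ij + E_ji), 0) detect M_ij + M_ji. Conversely, an alternating matrix times a symmetric one has
trace zero. -/
theorem forall_lam_trace_eq_one_iff [CharP F 2] [Fintype F] [DecidableEq F] {r : ℕ}
    (hF : Fintype.card F = 2 ^ r) {a : F} (ha : a ≠ 0) (M : Matrix (Fin n) (Fin n) F) :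
    (∀ p ∈ unipParam F n, lam r (a * trace (M * p.1)) = 1) ↔ IsAlternating M := by
  constructor
  · intro h1
    refine ⟨fun i => ?_, fun i j => ?_⟩
    · refine (mul_eq_zero.1 (eq_zero_of_forall_lam hF (b := a * M i i) fun c => ?_)).resolve_left
        ha
      obtain ⟨s, rfl⟩ : ∃ s, s ^ 2 = c := by
        obtain ⟨s, hs⟩ := surjective_frobenius F 2 c
        exact ⟨s, hs⟩
      have := h1 (single i i (s ^ 2), single () i s) <| mem_unipParam.2
        ⟨fun j => by by_cases hj : i = j <;> simp [hj],
          fun j l => by simp [single_apply, and_comm]⟩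
      rw [← this]
      congr 1
      simp [trace_mul_single]
      ring
    · by_cases hij : i = j
      · subst hij
        rw [CharTwo.neg_eq]
      rw [CharTwo.neg_eq, ← CharTwo.add_eq_zero]
      refine (mul_eq_zero.1 (eq_zero_of_forall_lam hF (b := a * (M i j + M j i))
        fun c => ?_)).resolve_left ha
      have := h1 (single i j c + single j i c, 0) <| mem_unipParam.2
        ⟨fun l => by
          simp only [Matrix.add_apply, single_apply]
          rw [if_neg (by rintro ⟨rfl, h⟩; exact hij h.symm),
            if_neg (by rintro ⟨rfl, h⟩; exact hij h)]
          simp,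
          fun l m => by simp [single_apply, and_comm, add_comm]⟩
      rw [← this]
      congr 1
      simp [mul_add, trace_mul_single]
      ring
  · intro hM p hp
    rw [trace_mul_eq_zero_of_alternating hM (mem_unipParam.1 hp).2]
    simp [lam, tr]

theorem sum_lam_trace_unipParam [CharP F 2] [Fintype F] [DecidableEq F] [Fintype (unipParam F n)] {r : ℕ}
    (hF : Fintype.card F = 2 ^ r) {a : F} (ha : a ≠ 0) (M : Matrix (Fin n) (Fin n) F)
    [Decidable (IsAlternating M)] :
    ∑ p : unipParam F n, lam r (a * trace (M * p.1.1)) =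
      if IsAlternating M then (Nat.card (unipParam F n) : ℂ) else 0 := by
  classical
  let φ : unipParam F n →+ F :=
    { toFun := fun p => a * trace (M * p.1.1)
      map_zero' := by simp
      map_add' := fun p p' => by simp [mul_add] }
  have hφ : ∀ p, (lamChar hF).compAddMonoidHom φ p = lam r (a * trace (M * p.1.1)) := fun _ => rfl
  have h := AddChar.sum_eq_ite ((lamChar hF).compAddMonoidHom φ)
  simp only [AddChar.eq_zero_iff, hφ] at h
  rw [Nat.card_eq_fintype_card, h]
  exact if_congr (by rw [← forall_lam_trace_eq_one_iff hF ha, Subtype.forall]) rfl rfl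

/-- The matrix whose last row is replaced by zero. -/
def eraseLastRow (A : Matrix (Fin (k + 1)) (Fin (k + 1)) F) :
    Matrix (Fin (k + 1)) (Fin (k + 1)) F :=
  diagonal (fun i : Fin (k + 1) => if (i : ℕ) < k then 1 else 0) * A

theorem eraseLastRow_castSucc (A : Matrix (Fin (k + 1)) (Fin (k + 1)) F) (i : Fin k)
    (j : Fin (k + 1)) : eraseLastRow A i.castSucc j = A i.castSucc j := by
  simp [eraseLastRow, diagonal_mul]

theorem eraseLastRow_last (A : Matrix (Fin (k + 1)) (Fin (k + 1)) F) (j : Fin (k + 1)) :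
    eraseLastRow A (Fin.last k) j = 0 := by
  simp [eraseLastRow, diagonal_mul]

/-- The zero last row forces a zero last column, while the original last row, corner included, stays
unconstrained. -/
theorem isAlternating_eraseLastRow_iff (A : Matrix (Fin (k + 1)) (Fin (k + 1)) F) :
    IsAlternating (eraseLastRow A) ↔
      LastColZero A ∧ IsAlternating (A.submatrix Fin.castSucc Fin.castSucc) := by
  simp only [IsAlternating, Fin.forall_fin_succ', eraseLastRow_castSucc, eraseLastRow_last,
    LastColZero, submatrix_apply, neg_zero]
  constructor
  · rintro ⟨⟨h1, -⟩, h2, -, -⟩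
    exact ⟨fun i => (h2 i).2, h1, fun i => (h2 i).1⟩
  · rintro ⟨h, h1, h2⟩
    exact ⟨⟨h1, trivial⟩, fun i => ⟨h2 i, h i⟩, by simp [h], trivial⟩

theorem trace_fromBlocks {m l : Type*} [Fintype m] [Fintype l] (A : Matrix m m F)
    (B : Matrix m l F) (C : Matrix l m F) (D : Matrix l l F) :
    trace (fromBlocks A B C D) = trace A + trace D := by
  simp [trace, Fintype.sum_sum_type]

/-- On the first k coordinates σ brings AB onto the diagonal; on coordinate k + 1 of each half it is
the identity and keeps the corners of A and A⁻¹; the fixed coordinate adds 1. -/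
theorem trace_levi_mul_unip_mul_sigma (A : GL (Fin (k + 1)) F)
    (B : Matrix (Fin (k + 1)) (Fin (k + 1)) F) (h : Matrix Unit (Fin (k + 1)) F) :
    trace (levi A * unip B h * sigma F (k + 1) k) =
      trace (eraseLastRow (A : Matrix (Fin (k + 1)) (Fin (k + 1)) F) * B) +
        ((A : Matrix (Fin (k + 1)) (Fin (k + 1)) F) (Fin.last k) (Fin.last k) +
          ((A⁻¹ : GL (Fin (k + 1)) F) : Matrix (Fin (k + 1)) (Fin (k + 1)) F) (Fin.last k)
             (Fin.last k)) + 1 := by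
  have h1 : ∀ M : Matrix (Fin (k + 1)) (Fin (k + 1)) F,
      trace (M * diagonal fun i : Fin (k + 1) => if (i : ℕ) < k then 0 else 1) =
        M (Fin.last k) (Fin.last k) := fun M => by
    simp [trace, Fin.sum_univ_castSucc, mul_diagonal]
  rw [levi_mul_unip, sigma, fromBlocks_multiply, fromBlocks_multiply]
  simp only [Matrix.mul_zero, Matrix.zero_mul, add_zero, zero_add, Matrix.mul_one,
    trace_fromBlocks, trace_add, trace_one, Fintype.card_unit, Nat.cast_one, h1]
  rw [eraseLastRow, Matrix.mul_assoc (diagonal _), trace_mul_comm (diagonal _), transpose_apply]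
  ring

theorem card_GL_alternating (F : Type*) [Field F] (k : ℕ) :
    Nat.card {A : GL (Fin k) F // IsAlternating (A : Matrix (Fin k) (Fin k) F)} =
      numNonsingAlt F k := by
  refine Nat.card_congr (Equiv.ofBijective
    (fun A => ⟨A.1.1, A.2, (isUnit_iff_isUnit_det _).1 A.1.isUnit⟩) ⟨fun A A' h => ?_, ?_⟩)
  · exact Subtype.ext (Units.ext (congrArg Subtype.val h))
  · rintro ⟨M, hM, hu⟩
    obtain ⟨A, rfl⟩ := (isUnit_iff_isUnit_det _).2 hu
    exact ⟨⟨A, hM⟩, rfl⟩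

theorem sum_lam_P [CharP F 2] [Fintype F] [DecidableEq F] [Fintype (P F (k + 1))] {r : ℕ}
    (hF : Fintype.card F = 2 ^ r) {a : F} (ha : a ≠ 0) :
    ∑ x : P F (k + 1), lam r (a * trace (x.1 * sigma F (k + 1) k)) =
      Nat.card (unipParam F (k + 1)) * lam r a * (Fintype.card F ^ k * numNonsingAlt F k) *
        kloosterman (lam r) a := by
  classical
  have : Fintype (unipParam F (k + 1)) := Fintype.ofFinite _
  have hadd : ∀ x y : F, lam r (x + y) = lam r x * lam r y := (lamChar hF).map_add_eq_mul
  rw [← (paramEquiv F (k + 1)).sum_comp, Fintype.sum_prod_type]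
  simp only [coe_paramEquiv, trace_levi_mul_unip_mul_sigma, mul_add, mul_one, hadd]
  simp only [← Finset.sum_mul, sum_lam_trace_unipParam hF ha, ite_mul, zero_mul,
    isAlternating_eraseLastRow_iff, ite_and]
  rw [← Finset.sum_filter, Finset.sum_subtype _
    (p := fun A : GL (Fin (k + 1)) F => LastColZero (A : Matrix (Fin (k + 1)) (Fin (k + 1)) F))
    (by simp), ← (lowerEquiv F k).sum_comp, Fintype.sum_prod_type]
  have hsub : ∀ (A : Matrix (Fin k) (Fin k) F) (w : Fin k → F) (d : F),
      (snocMat A 0 w d).submatrix Fin.castSucc Fin.castSucc = A := fun A w d => by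
    ext i j
    simp
  simp only [Fintype.sum_prod_type, lowerEquiv_apply, coe_lowerGL, coe_lowerGL_inv,
    snocMat_last_last, hsub, ← hadd, ← mul_add, Units.val_inv_eq_inv_val]
  have hN := card_GL_alternating F k
  rw [Nat.card_eq_fintype_card, Fintype.card_subtype] at hN
  rw [← hN, ← sum_lam_unit_add_inv hF ha]
  -- The summand does not involve w, which therefore contributes q ^ k.
  have hA : ∀ A : GL (Fin k) F, ∑ _w : Fin k → F, ∑ d : Fˣ,
      (if IsAlternating (A : Matrix (Fin k) (Fin k) F) then
        (Nat.card (unipParam F (k + 1)) : ℂ) * lam r (a * ((d : F) + (d : F)⁻¹)) * lam r a else 0) =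
      if IsAlternating (A : Matrix (Fin k) (Fin k) F) then
        Nat.card (unipParam F (k + 1)) * lam r a * (Fintype.card F : ℂ) ^ k *
          ∑ d : Fˣ, lam r (a * ((d : F) + (d : F)⁻¹)) else 0 := fun A => by
    split_ifs
    · rw [Finset.sum_const, ← Finset.sum_mul, ← Finset.mul_sum]
      simp
      ring
    · simp
  rw [Finset.sum_congr rfl fun A _ => hA A, ← Finset.sum_filter, Finset.sum_const, nsmul_eq_mul]
  ring

end CharacterSum

/-! ### The intersection of P with its conjugate by σ. -/

section Stabilizer

open Matrix

variable {F : Type*} [Field F] {k : ℕ}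

theorem sigma_mul_self (F : Type*) [Field F] (n r : ℕ) : sigma F n r * sigma F n r = 1 := by
  refine ext_of_mulVec_single fun i => ?_
  obtain ⟨u, v, z, h⟩ := exists_elim (Pi.single i (1 : F) : Idx n → F)
  rw [h, ← mulVec_mulVec, sigma_mulVec, sigma_mulVec, one_mulVec]
  congr 2 <;> ext i <;> split_ifs <;> rfl

theorem levi_mul_unip_mulVec {n : ℕ} (A : GL (Fin n) F) (B : Matrix (Fin n) (Fin n) F)
    (h : Matrix Unit (Fin n) F) (u v : Fin n → F) (z : Unit → F) :
    (levi A * unip B h) *ᵥ Sum.elim (Sum.elim u v) z =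
      Sum.elim (Sum.elim ((A : Matrix (Fin n) (Fin n) F) *ᵥ (u + B *ᵥ v))
        (((A⁻¹ : GL (Fin n) F) : Matrix (Fin n) (Fin n) F)ᵀ *ᵥ v)) (h *ᵥ v + z) := by
  rw [levi_mul_unip]
  simp [fromBlocks_mulVec, fromCols_mulVec, Function.comp_def, mulVec_add]

theorem sigma_conj_mem_P_iff [CharP F 2] (A : GL (Fin (k + 1)) F) (p : unipParam F (k + 1)) :
    sigma F (k + 1) k * (levi A * unip p.1.1 p.1.2) * sigma F (k + 1) k ∈ P F (k + 1) ↔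
      LastColZero (A : Matrix (Fin (k + 1)) (Fin (k + 1)) F) ∧
        ∀ i j : Fin k, p.1.1 i.castSucc j.castSucc = 0 := by
  have hO : sigma F (k + 1) k * (levi A * unip p.1.1 p.1.2) * sigma F (k + 1) k ∈ O F (k + 1) :=
    mul_mem_O (mul_mem_O (sigma_mem_O _ _ _) (P_subset_O _ _ ⟨A, p.1.1, p.1.2, p.2, rfl⟩))
      (sigma_mem_O _ _ _)
  rw [mem_P_iff, and_iff_right hO]
  have hlt : ∀ i : Fin k, (i.castSucc : ℕ) < k := fun i => i.2
  have hlast : ¬ (Fin.last k : ℕ) < k := lt_irrefl k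
  -- For an isometry only the stabilizer condition matters: the second half and the last coordinate
  -- of the image must vanish. Here σ moves the first k entries of u to the second half, where B,
  -- A⁻ᵀ and h act on them.
  have hQ : ∀ u : Fin (k + 1) → F, (∃ u' : Fin (k + 1) → F,
      (sigma F (k + 1) k * (levi A * unip p.1.1 p.1.2) * sigma F (k + 1) k) *ᵥ
        Sum.elim (Sum.elim u (0 : Fin (k + 1) → F)) (0 : Unit → F) =
          Sum.elim (Sum.elim u' (0 : Fin (k + 1) → F)) (0 : Unit → F)) ↔
      (∀ i : Fin k, ((A : Matrix (Fin (k + 1)) (Fin (k + 1)) F) *ᵥ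
        ((fun j : Fin (k + 1) => if (j : ℕ) < k then 0 else u j) +
          p.1.1 *ᵥ fun j : Fin (k + 1) => if (j : ℕ) < k then u j else 0)) i.castSucc = 0) ∧
      (((A⁻¹ : GL (Fin (k + 1)) F) : Matrix (Fin (k + 1)) (Fin (k + 1)) F)ᵀ *ᵥ
        fun j : Fin (k + 1) => if (j : ℕ) < k then u j else 0) (Fin.last k) = 0 ∧
      (p.1.2 *ᵥ fun j : Fin (k + 1) => if (j : ℕ) < k then u j else 0) = 0 := by
    intro u
    rw [← mulVec_mulVec, ← mulVec_mulVec, sigma_mulVec, levi_mul_unip_mulVec, sigma_mulVec]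
    simp only [Sum.elim_eq_iff, add_zero]
    constructor
    · rintro ⟨u', ⟨-, h1⟩, h2⟩
      refine ⟨fun i => ?_, ?_, h2⟩
      · have := congrFun h1 i.castSucc
        rwa [if_pos (hlt i)] at this
      · have := congrFun h1 (Fin.last k)
        rwa [if_neg hlast] at this
    · rintro ⟨h1, h2, h3⟩
      refine ⟨_, ⟨rfl, funext fun i => ?_⟩, h3⟩
      induction i using Fin.lastCases with
      | last => rwa [if_neg hlast]
      | cast i => rw [if_pos (hlt i)]; exact h1 i
  simp only [hQ]
  constructor
  · intro h
    have hA : LastColZero (A : Matrix (Fin (k + 1)) (Fin (k + 1)) F) := fun i => by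
      -- The last basis vector is fixed by σ and exposes the last column of A; the earlier ones,
      -- used below, expose the columns of A₁ times the upper left block of B.
      have := (h (Pi.single (Fin.last k) 1)).1 i
      simpa [mulVec, dotProduct, Fin.sum_univ_castSucc] using this
    refine ⟨hA, fun i j => ?_⟩
    obtain ⟨⟨A₁, w, d⟩, hAd⟩ := (lowerEquiv F k).surjective ⟨A, hA⟩
    obtain rfl : lowerGL A₁ w d = A := congrArg Subtype.val hAd
    have h1 : (A₁ : Matrix (Fin k) (Fin k) F) *ᵥ (fun l => p.1.1 l.castSucc j.castSucc) = 0 := by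
      ext i
      have := (h (Pi.single j.castSucc 1)).1 i
      simpa [coe_lowerGL, mulVec, dotProduct, Fin.sum_univ_castSucc, Pi.single_apply] using this
    have h2 := congrArg (((A₁⁻¹ : GL (Fin k) F) : Matrix (Fin k) (Fin k) F) *ᵥ ·) h1
    simp only [mulVec_mulVec, ← Units.val_mul, inv_mul_cancel, mulVec_zero, Units.val_one,
      one_mulVec] at h2
    exact congrFun h2 i
  · rintro ⟨hA, hB⟩ u
    have hh : ∀ j : Fin k, p.1.2 () j.castSucc = 0 := fun j => by
      have := (mem_unipParam.1 p.2).1 j.castSucc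
      rw [hB] at this
      exact (pow_eq_zero_iff two_ne_zero).1 this.symm
    obtain ⟨⟨A₁, w, d⟩, hAd⟩ := (lowerEquiv F k).surjective ⟨A, hA⟩
    obtain rfl : lowerGL A₁ w d = A := congrArg Subtype.val hAd
    refine ⟨fun i => ?_, ?_, ?_⟩
    · simp [coe_lowerGL, mulVec, dotProduct, Fin.sum_univ_castSucc, hB]
    · rw [coe_lowerGL_inv]
      simp [mulVec, dotProduct, Fin.sum_univ_castSucc]
    · ext i
      simp [mulVec, dotProduct, Fin.sum_univ_castSucc, hh]

theorem card_sigma_conj_mem_P (F : Type*) [Field F] [Fintype F] [CharP F 2] (k : ℕ) :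
    Nat.card {x : P F (k + 1) // sigma F (k + 1) k * x.1 * sigma F (k + 1) k ∈ P F (k + 1)} =
      Nat.card (GL (Fin k) F) * (Fintype.card F ^ k * (Fintype.card F - 1)) *
        Fintype.card F ^ (k + 1) := by
  classical
  have e : {x : P F (k + 1) // sigma F (k + 1) k * x.1 * sigma F (k + 1) k ∈ P F (k + 1)} ≃
      {A : GL (Fin (k + 1)) F // LastColZero (A : Matrix (Fin (k + 1)) (Fin (k + 1)) F)} ×
        {p : unipParam F (k + 1) // ∀ i j : Fin k, p.1.1 i.castSucc j.castSucc = 0} :=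
    ((paramEquiv F (k + 1)).subtypeEquiv (p := fun q =>
      LastColZero (q.1 : Matrix (Fin (k + 1)) (Fin (k + 1)) F) ∧
        ∀ i j : Fin k, q.2.1.1 i.castSucc j.castSucc = 0)
      fun q => (sigma_conj_mem_P_iff q.1 q.2).symm).symm.trans
        (Equiv.subtypeProdEquivProd (p := fun A : GL (Fin (k + 1)) F => LastColZero A.1)
          (q := fun p : unipParam F (k + 1) => ∀ i j : Fin k, p.1.1 i.castSucc j.castSucc = 0))
  rw [Nat.card_congr e, Nat.card_prod, card_unipParam_block_zero,
    ← Nat.card_congr (lowerEquiv F k), Nat.card_prod, Nat.card_prod]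
  rw [Nat.card_units]
  simp

end Stabilizer

/-! ### Assembling the count and the character sum. -/

section Main

open Matrix

variable {F : Type*} [Field F] [Fintype F] [DecidableEq F]

theorem card_P (F : Type*) [Field F] [Fintype F] [CharP F 2] (n : ℕ) :
    Nat.card (P F n) = Nat.card (GL (Fin n) F) * Nat.card (unipParam F n) := by
  rw [← Nat.card_congr (paramEquiv F n), Nat.card_prod]

theorem card_mul_sum_DC [CharP F 2] {r : ℕ} (hF : Fintype.card F = 2 ^ r) (k : ℕ) {a : F}
    (ha : a ≠ 0) :
    ((Nat.card (GL (Fin k) F) * (Fintype.card F ^ k * (Fintype.card F - 1)) *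
        Fintype.card F ^ (k + 1) : ℕ) : ℂ) *
      ∑ w ∈ (Set.toFinite (DC F (k + 1))).toFinset, lam r (a * trace w) =
    (Nat.card (GL (Fin (k + 1)) F) * Nat.card (unipParam F (k + 1)) : ℕ) *
      (Nat.card (unipParam F (k + 1)) * lam r a * (Fintype.card F ^ k * numNonsingAlt F k) *
        kloosterman (lam r) a) := by
  classical
  have : Fintype (P F (k + 1)) := Fintype.ofFinite _
  have h := card_mul_sum_doubleCoset (P F (k + 1)).toFinset
    (fun x hx y hy => by
      rw [Set.mem_toFinset] at *
      exact mul_mem_P hx hy)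
    (fun x hx => by
      obtain ⟨y, hy, h⟩ := exists_inv_mem_P (Set.mem_toFinset.1 hx)
      exact ⟨y, Set.mem_toFinset.2 hy, h⟩)
    (sigma F (k + 1) k) (sigma_mul_self F (k + 1) k) (fun w => lam r (a * trace w))
    (fun x y => by rw [trace_mul_comm]) (Set.toFinite (DC F (k + 1))).toFinset
    (fun w => by simp [DC, DoubleCoset.mem_doubleCoset])
  rw [← card_sigma_conj_mem_P, ← card_P, ← sum_lam_P hF ha]
  convert h using 2
  · rw [Nat.card_eq_fintype_card, Fintype.card_subtype]
    congr 1
    refine Finset.card_bij (fun x _ => x.1) (fun x hx => ?_) (fun x _ y _ h => ?_)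
      fun x hx => ?_
    · simpa using hx
    · exact Subtype.ext h
    · have hx' := Finset.mem_filter.1 hx
      exact ⟨⟨x, Set.mem_toFinset.1 hx'.1⟩, by simpa using hx'.2, rfl⟩
  · rw [Nat.card_eq_fintype_card, Set.toFinset_card]
  · exact Finset.sum_set_coe (P F (k + 1)) (f := fun x => lam r (a * trace (x * sigma F (k + 1) k)))

end Main

end OrthKloosterman

theorem mainTheorem7 {F : Type*} [Field F] [Fintype F] [DecidableEq F]
    (r : ℕ) (hF : Fintype.card F = 2 ^ r) (n : ℕ) (hn : Odd n) (a : F) (ha : a ≠ 0) :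
    ∑ w ∈ (Set.toFinite (OrthKloosterman.DC F n)).toFinset,
        OrthKloosterman.lam r (a * Matrix.trace w) =
      OrthKloosterman.lam r a * OrthKloosterman.A n (Fintype.card F) *
        OrthKloosterman.kloosterman (OrthKloosterman.lam r) a := by
  have : Fact (Nat.Prime 2) := ⟨Nat.prime_two⟩
  have : CharP F 2 := charP_of_card_eq_prime_pow hF
  obtain ⟨m, rfl⟩ := hn
  have h := OrthKloosterman.card_mul_sum_DC hF (2 * m) ha
  have hq1 : 1 < Fintype.card F := Fintype.one_lt_card
  have hqn : 1 ≤ Fintype.card F ^ (2 * m + 1) := Nat.one_le_pow _ _ hq1.le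
  have hGL : (Nat.card (Matrix.GeneralLinearGroup (Fin (2 * m)) F) : ℂ) ≠ 0 :=
    Nat.cast_ne_zero.2 Nat.card_pos.ne'
  rw [OrthKloosterman.card_GL_succ, OrthKloosterman.card_unipParam,
    OrthKloosterman.numNonsingAlt_two_mul] at h
  have h5 : (5 * (2 * m + 1) ^ 2 - 1) / 4 = 5 * m ^ 2 + 5 * m + 1 := by
    have : 5 * (2 * m + 1) ^ 2 - 1 = 4 * (5 * m ^ 2 + 5 * m + 1) := by
      rw [Nat.sub_eq_iff_eq_add (Nat.one_le_iff_ne_zero.2 (by positivity))]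
      ring
    omega
  have h6 : (2 * m + 1) * (2 * m + 1 - 1) / 2 = (2 * m + 1) * m := by
    rw [Nat.add_sub_cancel, mul_left_comm, Nat.mul_div_cancel_left _ two_pos]
  have h7 : (m : ℕ) * (m - 1) + m = m ^ 2 := by
    cases m <;> simp
    ring
  rw [h6] at h
  rw [OrthKloosterman.A, OrthKloosterman.qBinom, h5, show (2 * m + 1 - 1) / 2 = m by omega]
  push_cast [hq1.le, hqn] at h
  simp only [Finset.prod_range_one, Nat.sub_zero, pow_one]
  have hq : (Fintype.card F : ℂ) - 1 ≠ 0 := by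
    rw [sub_ne_zero]
    exact_mod_cast hq1.ne'
  have hq0 : (Fintype.card F : ℂ) ≠ 0 := by exact_mod_cast (zero_lt_one.trans hq1).ne'
  generalize (Fintype.card F : ℂ) = q at *
  -- The radical's order enters twice, once from |P| and once from the character sum. On the right,
  -- 5m² + 5m + 1 = (5n² - 1)/4 for n = 2m + 1.
  have hpow : q ^ (2 * m) * q ^ ((2 * m + 1) * m + (2 * m + 1)) *
      (q ^ ((2 * m + 1) * m + (2 * m + 1)) * (q ^ (2 * m) * q ^ (m * (m - 1)))) =
        q ^ (2 * m) * q ^ (2 * m + 1) * q ^ (5 * m ^ 2 + 5 * m + 1) := by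
    simp only [← pow_add]
    congr 1
    linear_combination h7
  have hdiv : (q - 1) * ((q ^ (2 * m + 1) - 1) / (q - 1)) = q ^ (2 * m + 1) - 1 :=
    mul_div_cancel₀ _ hq
  -- The cancelled factor is |P ∩ σPσ|; with all powers of q made atoms, `hpow` and `hdiv` finish.
  refine mul_left_cancel₀ (mul_ne_zero (mul_ne_zero hGL (mul_ne_zero (pow_ne_zero (2 * m) hq0) hq))
    (pow_ne_zero (2 * m + 1) hq0)) (h.trans ?_)
  generalize (q ^ (2 * m + 1) - 1) / (q - 1) = D at *
  generalize ∏ j ∈ Finset.Icc 1 m, (q ^ (2 * j - 1) - 1) = R at *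
  generalize q ^ (5 * m ^ 2 + 5 * m + 1) = X at *
  generalize q ^ (m * (m - 1)) = Y at *
  generalize q ^ ((2 * m + 1) * m + (2 * m + 1)) = E at *
  generalize q ^ (2 * m + 1) = Z at *
  generalize q ^ (2 * m) = W at *
  generalize (Nat.card (Matrix.GeneralLinearGroup (Fin (2 * m)) F) : ℂ) = G at *
  generalize OrthKloosterman.lam r a = l at *
  generalize OrthKloosterman.kloosterman (OrthKloosterman.lam r) a = K at *
  linear_combination G * l * R * K * (Z - 1) * hpow - G * W * Z * X * l * R * K * hdiv
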